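/- Let $k$ be a field, let $\Lambda$ be a finite dimensional $k$-algebra, and let $n\ge 1$ be an integer with $\operatorname{gl.dim}\Lambda\le n$. Let $\operatorname{mod}\Lambda$ be the category of finitely generated right $\Lambda$-modules, and let $\mathcal D=\mathcal K^{\rm b}(\operatorname{proj}\Lambda)$ be the homotopy category of bounded complexes of finitely generated projective right $\Lambda$-modules. Since $\operatorname{gl.dim}\Lambda<\infty$, each $X\in\operatorname{mod}\Lambda$ is regarded as an object of $\mathcal D$ by means of a bounded resolution of $X$ by finitely generated projective modules. A full subcategory $\mathcal C$ of a category $\mathcal X$ is called functorially finite if every $X\in\mathcal X$ admits a morphism $f\colon C\to X$ with $C\in\mathcal C$ through which every morphism from an object of $\mathcal C$ to $X$ factors, and dually a morphism $g\colon X\to C'$ with $C'\in\mathcal C$ through which every morphism from $X$ to an object of $\mathcal C$ factors. An (absolute) $n$-cluster tilting subcategory of $\operatorname{mod}\Lambda$ is a functorially finite full subcategory $\mathcal C$ of $\operatorname{mod}\Lambda$ such that \begin{align*} \mathcal C&=\{X\in\operatorname{mod}\Lambda \mid \operatorname{Ext}^i_\Lambda(X,Y)=0 \text{ for all } Y\in\mathcal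 C,\ 0<i<n\}\\ &=\{X\in\operatorname{mod}\Lambda \mid \operatorname{Ext}^i_\Lambda(Y,X)=0 \text{ for all } Y\in\mathcal C,\ 0<i<n\}. \end{align*} Likewise, an $n$-cluster tilting subcategory of $\mathcal D$ is a functorially finite full subcategory $\mathcal B$ of $\mathcal D$ such that \begin{align*} \mathcal B&=\{X\in\mathcal D \mid \operatorname{Hom}_{\mathcal D}(X,Y[i])=0 \text{ for all } Y\in\mathcal B,\ 0<i<n\}\\ &=\{X\in\mathcal D \mid \operatorname{Hom}_{\mathcal D}(Y,X[i])=0 \text{ for all } Y\in\mathcal B,\ 0<i<n\}. \end{align*} Let $\mathcal C$ be an absolute $n$-cluster tilting subcategory of $\operatorname{mod}\Lambda$. Then $$\mathcal C[n\mathbf Z]:=\operatorname{add}\{X[\ell n]\mid X\in\mathcal C,\ \ell\in\mathbf Z\},$$ the full subcategory of $\mathcal D$ consisting of all direct summands of finite direct sums of objects $X[\ell n]$ with $X\in\mathcal C$ and $\ell\in\mathbf Z$, is an $n$-cluster tilting subcategory of $\mathcal D$. -/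

import Mathlib

open CategoryTheory CategoryTheory.Limits

universe u v w

namespace ClusterTilting

section Categories

variable {T : Type u} [Category.{v} T]

/-- A full subcategory `B` of `T` is contravariantly finite if every object of `T` has a
right `B`-approximation. -/
def IsContravariantlyFinite (B : ObjectProperty T) : Prop :=
  ∀ X : T, ∃ (C : T) (f : C ⟶ X), B C ∧
    ∀ (C' : T), B C' → ∀ g : C' ⟶ X, ∃ h : C' ⟶ C, h ≫ f = g

/-- A full subcategory `B` of `T` is covariantly finite if every object of `T` has a
left `B`-approximation. -/
def IsCovariantlyFinite (B : ObjectProperty T) : Prop :=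
  ∀ X : T, ∃ (C : T) (f : X ⟶ C), B C ∧
    ∀ (C' : T), B C' → ∀ g : X ⟶ C', ∃ h : C ⟶ C', f ≫ h = g

/-- Functorially finite subcategories. -/
def IsFunctoriallyFinite (B : ObjectProperty T) : Prop :=
  IsContravariantlyFinite B ∧ IsCovariantlyFinite B

variable [Preadditive T]

/-- `add S`: the direct summands of finite direct sums of objects of `S`. -/
def add (S : ObjectProperty T) : ObjectProperty T := fun X =>
  ∃ (m : ℕ) (Y : Fin m → T) (b : Bicone Y),
    (∀ j, S (Y j)) ∧ Nonempty b.IsBilimit ∧ Nonempty (Retract X b.pt)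

/-- `n`-cluster tilting subcategories of a triangulated category with shift `[1]`. The two
equalities force such a subcategory to be closed under isomorphisms, finite direct sums and
direct summands. -/
structure IsTriangulatedClusterTilting [HasShift T ℤ] (n : ℕ) (B : ObjectProperty T) : Prop where
  functoriallyFinite : IsFunctoriallyFinite B
  iff_left : ∀ X : T, B X ↔
    ∀ Y : T, B Y → ∀ i : ℤ, 0 < i → i < n → ∀ f : X ⟶ Y⟦i⟧, f = 0
  iff_right : ∀ X : T, B X ↔
    ∀ Y : T, B Y → ∀ i : ℤ, 0 < i → i < n → ∀ f : Y ⟶ X⟦i⟧, f = 0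

end Categories

section Modules

variable (R : Type u) [Ring R]

/-- The global dimension of `R`: the supremum of the projective dimensions of all `R`-modules. -/
noncomputable def globalDimension : WithBot ℕ∞ :=
  ⨆ M : ModuleCat.{u} R, projectiveDimension M

variable {R} in
/-- (Absolute) `n`-cluster tilting subcategories of the category of finitely generated
`R`-modules. The two equalities force such a subcategory to be closed under isomorphisms,
finite direct sums and direct summands. -/
structure IsModuleClusterTilting (n : ℕ) (C : ObjectProperty (FGModuleCat.{u} R)) : Prop where
  functoriallyFinite : IsFunctoriallyFinite C
  iff_left : ∀ X : FGModuleCat.{u} R, C X ↔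
    ∀ Y : FGModuleCat.{u} R, C Y → ∀ i : ℕ, 0 < i → i < n →
      Subsingleton (Abelian.Ext X.obj Y.obj i)
  iff_right : ∀ X : FGModuleCat.{u} R, C X ↔
    ∀ Y : FGModuleCat.{u} R, C Y → ∀ i : ℕ, 0 < i → i < n →
      Subsingleton (Abelian.Ext Y.obj X.obj i)

/-- Bounded cochain complexes of finitely generated projective `R`-modules. -/
def boundedProj : ObjectProperty (CochainComplex (ModuleCat.{u} R) ℤ) := fun K =>
  (∃ a b : ℤ, K.IsStrictlyGE a ∧ K.IsStrictlyLE b) ∧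
    ∀ i : ℤ, Module.Finite R (K.X i) ∧ Module.Projective R (K.X i)

/-- The objects of the homotopy category given by bounded complexes of finitely generated
projective `R`-modules. -/
def homotopyBoundedProj : ObjectProperty (HomotopyCategory (ModuleCat.{u} R) (.up ℤ)) :=
  fun K => boundedProj R K.as

instance : (homotopyBoundedProj R).IsStableUnderShift ℤ where
  isStableUnderShiftBy n :=
    { le_shift K hK := by
        obtain ⟨K : CochainComplex _ _, rfl⟩ := K.quotient_obj_surjective
        obtain ⟨⟨a, b, (_ : K.IsStrictlyGE a), (_ : K.IsStrictlyLE b)⟩, h⟩ := hK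
        rw [ObjectProperty.prop_shift_iff, HomotopyCategory.shift_quotient_obj]
        exact ⟨⟨a - n, b - n, K.isStrictlyGE_shift a n (a - n) (by lia),
          K.isStrictlyLE_shift b n (b - n) (by lia)⟩, fun i => h (i + n)⟩ }

/-- `K^b(proj R)`, the homotopy category of bounded complexes of finitely generated projective
`R`-modules, as a full subcategory of the homotopy category of complexes of `R`-modules. -/
abbrev Kb : Type (u + 1) := (homotopyBoundedProj R).FullSubcategory

variable {R}

/-- `P` in `K^b(proj R)` represents the module `X`: there is a quasi-isomorphism from `P` to the
stalk complex of `X` in degree `0`. As `P` is a bounded complex of projectives, this says that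
`P` and `X` are isomorphic in the derived category. -/
def Represents (P : Kb R) (X : FGModuleCat.{u} R) : Prop :=
  ∃ f : P.obj.as ⟶ (CochainComplex.singleFunctor (ModuleCat.{u} R) 0).obj X.obj, QuasiIso f

/-- The objects `X[ℓ n]` of `K^b(proj R)`, for `X` in `C` and `ℓ` an integer. -/
def shifts (n : ℕ) (C : ObjectProperty (FGModuleCat.{u} R)) : ObjectProperty (Kb R) := fun Y =>
  ∃ (X : FGModuleCat.{u} R) (P : Kb R) (ℓ : ℤ),
    C X ∧ Represents P X ∧ Nonempty (Y ≅ P⟦ℓ * (n : ℤ)⟧)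

/-- `C[nℤ] = add {X[ℓ n] | X ∈ C, ℓ ∈ ℤ}`. -/
def shiftClosure (n : ℕ) (C : ObjectProperty (FGModuleCat.{u} R)) : ObjectProperty (Kb R) :=
  add (shifts n C)

end Modules

end ClusterTilting

namespace ClusterTilting

/-! ### Stalk complexes, truncation and splitting in the derived category -/

section Derived

open Pretriangulated DerivedCategory

universe w' v' u'

variable {A : Type u'} [Category.{v'} A] [Abelian A] [HasDerivedCategory.{w'} A]

/-- The objects `(singleFunctor A j).obj N` in different degrees are related by shifts. -/
noncomputable def singleShiftIso (N : A) (i a b : ℤ) (h : i + a = b) :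
    ((singleFunctor A b).obj N)⟦i⟧ ≅ (singleFunctor A a).obj N :=
  ((singleFunctors A).shiftIso i a b h).app N

/-- The stalk complex in degree `a` is `M[-a]`, so a morphism from degree `a` to degree `b` is a
class in Ext of degree `a - b`. -/
lemma single_hom_eq_zero_of_ext [HasExt.{w} A] (M N : A) (a b : ℤ) (i : ℕ) (h : b + i = a)
    (hE : Subsingleton (Abelian.Ext M N i))
    (f : (singleFunctor A a).obj M ⟶ (singleFunctor A b).obj N) : f = 0 := by
  have hs : ∀ g : (singleFunctor A 0).obj M ⟶ ((singleFunctor A 0).obj N)⟦(i : ℤ)⟧, g = 0 := by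
    intro g
    have := (Abelian.Ext.homEquiv (X := M) (Y := N) (n := i)).symm.subsingleton
    exact Subsingleton.elim _ _
  apply (shiftFunctor (DerivedCategory A) a).map_injective
  rw [Functor.map_zero]
  have e₁ := singleShiftIso M a 0 a (by lia)
  have e₂ : ((singleFunctor A b).obj N)⟦a⟧ ≅ ((singleFunctor A 0).obj N)⟦(i : ℤ)⟧ :=
    singleShiftIso N a (-i) b (by lia) ≪≫ (singleShiftIso N i (-i) 0 (by lia)).symm
  have := hs (e₁.inv ≫ (shiftFunctor (DerivedCategory A) a).map f ≫ e₂.hom)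
  rwa [← Category.assoc, Preadditive.IsIso.comp_right_eq_zero,
    Preadditive.IsIso.comp_left_eq_zero] at this

lemma subsingleton_ext_of_single_hom [HasExt.{w} A] (M N : A) (a b : ℤ) (i : ℕ) (h : b + i = a)
    (hE : ∀ f : (singleFunctor A a).obj M ⟶ (singleFunctor A b).obj N, f = 0) :
    Subsingleton (Abelian.Ext M N i) := by
  have hs : ∀ g : (singleFunctor A 0).obj M ⟶ ((singleFunctor A 0).obj N)⟦(i : ℤ)⟧, g = 0 := by
    intro g
    apply (shiftFunctor (DerivedCategory A) (-a)).map_injective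
    rw [Functor.map_zero]
    have e₁ := singleShiftIso M (-a) a 0 (by lia)
    have e₂ : (((singleFunctor A 0).obj N)⟦(i : ℤ)⟧)⟦-a⟧ ≅ (singleFunctor A b).obj N :=
      (shiftFunctor _ (-a)).mapIso (singleShiftIso N i (-i) 0 (by lia)) ≪≫
        singleShiftIso N (-a) b (-i) (by lia)
    have := hE (e₁.inv ≫ (shiftFunctor (DerivedCategory A) (-a)).map g ≫ e₂.hom)
    rwa [← Category.assoc, Preadditive.IsIso.comp_right_eq_zero,
      Preadditive.IsIso.comp_left_eq_zero] at this
  have : Subsingleton (ShiftedHom ((singleFunctor A 0).obj M) ((singleFunctor A 0).obj N)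
      (i : ℤ)) := ⟨fun a b => (hs a).trans (hs b).symm⟩
  exact (Abelian.Ext.homEquiv (X := M) (Y := N) (n := i)).subsingleton

lemma single_hom_eq_zero_of_lt (M N : A) (a b : ℤ) (h : a < b)
    (f : (singleFunctor A a).obj M ⟶ (singleFunctor A b).obj N) : f = 0 :=
  TStructure.t.zero f a b h

lemma isZero_homology_single (N : A) {a j : ℤ} (h : j ≠ a) :
    IsZero ((homologyFunctor A j).obj ((singleFunctor A a).obj N)) := by
  rcases lt_or_gt_of_ne h with h | h
  · exact isZero_of_isGE _ a j h
  · exact isZero_of_isLE _ a j h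

/-- Stalk complexes in the derived category are the images of stalk complexes. -/
noncomputable def singleIsoQ (N : A) (a : ℤ) : (singleFunctor A a).obj N ≅
    Q.obj ((HomologicalComplex.single A (ComplexShape.up ℤ) a).obj N) :=
  Iso.refl _

/-- The homology of the image of a complex in the derived category. -/
noncomputable def homologyQIso (K : CochainComplex A ℤ) (j : ℤ) :
    (homologyFunctor A j).obj (Q.obj K) ≅ K.homology j :=
  (homologyFunctorFactors A j).app K

lemma homologyQIso_hom_naturality {K L : CochainComplex A ℤ} (c : K ⟶ L) (j : ℤ) :
    (homologyFunctor A j).map (Q.map c) ≫ (homologyQIso L j).hom =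
      (homologyQIso K j).hom ≫ HomologicalComplex.homologyMap c j :=
  homologyFunctorFactors_hom_naturality c j

/-- The homology of a stalk complex in its degree. -/
noncomputable def homologySingleIso (N : A) (a : ℤ) :
    (homologyFunctor A a).obj ((singleFunctor A a).obj N) ≅ N :=
  (homologyFunctor A a).mapIso (singleIsoQ N a) ≪≫
    homologyQIso ((HomologicalComplex.single A _ a).obj N) a ≪≫
    HomologicalComplex.singleObjHomologySelfIso _ a N

lemma isIso_homology_map_mor₁ (T : Triangle (DerivedCategory A)) (hT : T ∈ distTriang _)
    (j : ℤ) (h₀ : IsZero ((homologyFunctor A (j - 1)).obj T.obj₃))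
    (h₁ : IsZero ((homologyFunctor A j).obj T.obj₃)) :
    IsIso ((homologyFunctor A j).map T.mor₁) := by
  have : Mono ((homologyFunctor A j).map T.mor₁) :=
    (HomologySequence.mono_homologyMap_mor₁_iff T hT (j - 1) j).2 (h₀.eq_of_src _ _)
  have : Epi ((homologyFunctor A j).map T.mor₁) :=
    (HomologySequence.epi_homologyMap_mor₁_iff T hT j).2 (h₁.eq_of_tgt _ _)
  exact isIso_of_mono_of_epi _

lemma isIso_homology_map_mor₂ (T : Triangle (DerivedCategory A)) (hT : T ∈ distTriang _)
    (j : ℤ) (h₀ : IsZero ((homologyFunctor A j).obj T.obj₁))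
    (h₁ : IsZero ((homologyFunctor A (j + 1)).obj T.obj₁)) :
    IsIso ((homologyFunctor A j).map T.mor₂) := by
  have : Mono ((homologyFunctor A j).map T.mor₂) :=
    (HomologySequence.mono_homologyMap_mor₂_iff T hT j).2 (h₀.eq_of_src _ _)
  have : Epi ((homologyFunctor A j).map T.mor₂) :=
    (HomologySequence.epi_homologyMap_mor₂_iff T hT j (j + 1)).2 (h₁.eq_of_tgt _ _)
  exact isIso_of_mono_of_epi _

/-- The lowest truncation triangle of an object which is `≥ a`. -/
lemma exists_lowest_truncation (X : DerivedCategory A) (a : ℤ) [X.IsGE a] :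
    ∃ (X' : DerivedCategory A) (f : (singleFunctor A a).obj ((homologyFunctor A a).obj X) ⟶ X)
      (g : X ⟶ X') (h : X' ⟶ ((singleFunctor A a).obj ((homologyFunctor A a).obj X))⟦(1 : ℤ)⟧),
      Triangle.mk f g h ∈ distTriang _ ∧ X'.IsGE (a + 1) ∧
      ∀ j, a < j → IsIso ((homologyFunctor A j).map g) := by
  obtain ⟨Y, X', hY, hX', f, g, h, mem⟩ := TStructure.t.exists_triangle X a (a + 1) rfl
  have : Y.IsLE a := ⟨hY⟩
  have hX'' : X'.IsGE (a + 1) := ⟨hX'⟩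
  have hf (j : ℤ) (hj : j ≤ a) : IsIso ((homologyFunctor A j).map f) :=
    isIso_homology_map_mor₁ _ mem j (isZero_of_isGE X' (a + 1) _ (by lia))
      (isZero_of_isGE X' (a + 1) _ (by lia))
  -- The truncation `Y` shares the cohomology of `X` up to degree `a`, so it is concentrated in
  -- degree `a` and is the stalk of `H^a(X)`.
  have : Y.IsGE a := by
    rw [isGE_iff]
    intro i hi
    have := hf i hi.le
    exact (isZero_of_isGE X a i hi).of_iso (asIso ((homologyFunctor A i).map f))
  obtain ⟨N, ⟨e⟩⟩ := exists_iso_singleFunctor_obj_of_isGE_of_isLE Y a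
  have := hf a le_rfl
  let e' : (singleFunctor A a).obj ((homologyFunctor A a).obj X) ≅ Y :=
    (singleFunctor A a).mapIso ((asIso ((homologyFunctor A a).map f)).symm ≪≫
      (homologyFunctor A a).mapIso e ≪≫ homologySingleIso N a) ≪≫ e.symm
  refine ⟨X', e'.hom ≫ f, g, h ≫ e'.inv⟦1⟧', ?_, hX'', fun j hj => ?_⟩
  · refine isomorphic_distinguished _ mem _ (Triangle.isoMk _ _ e' (Iso.refl _) (Iso.refl _)
      (Category.comp_id _) ((Category.comp_id _).trans (Category.id_comp _).symm) ?_)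
    dsimp only [Triangle.mk, Iso.refl]
    rw [Category.assoc, ← Functor.map_comp, e'.inv_hom_id, CategoryTheory.Functor.map_id]
    exact (Category.comp_id _).trans (Category.id_comp _).symm
  · exact isIso_homology_map_mor₂ _ mem j (isZero_of_isLE Y a _ (by lia))
      (isZero_of_isLE Y a _ (by lia))

/-- A bounded object belongs to any class of objects which is closed under extensions and
contains its cohomology objects. -/
lemma prop_of_bounded (Φ : ObjectProperty (DerivedCategory A))
    (hz : ∀ Z, IsZero Z → Φ Z)
    (hext : ∀ T ∈ distTriang (DerivedCategory A), Φ T.obj₁ → Φ T.obj₃ → Φ T.obj₂)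
    (X : DerivedCategory A) (a b : ℤ) [X.IsGE a] [X.IsLE b]
    (hX : ∀ j, a ≤ j → j ≤ b → Φ ((singleFunctor A j).obj ((homologyFunctor A j).obj X)))
    (hiso : Φ.IsClosedUnderIsomorphisms) : Φ X := by
  obtain ⟨m, hm⟩ : ∃ m : ℕ, b < a + m := ⟨(b + 1 - a).toNat, by lia⟩
  induction m generalizing X a with
  | zero => exact hz _ (TStructure.t.isZero X b a (by lia))
  | succ m ih =>
    obtain ⟨X', f, g, h, mem, hX', hg⟩ := exists_lowest_truncation X a
    by_cases hab : b < a
    · exact hz _ (TStructure.t.isZero X b a (by lia))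
    refine hext _ mem (hX a le_rfl (by lia)) ?_
    have : X'.IsLE b := by
      rw [isLE_iff]
      intro i hi
      have := hg i (by lia)
      exact (isZero_of_isLE X b i hi).of_iso (asIso ((homologyFunctor A i).map g)).symm
    refine ih X' (a + 1) (fun j hj hj' => ?_) (by push_cast at hm; lia)
    have := hg j (by lia)
    exact Φ.prop_of_iso ((singleFunctor A j).mapIso (asIso ((homologyFunctor A j).map g)))
      (hX j (by lia) hj')

/-- Having only zero morphisms to a fixed object is stable under extensions, which reduces to stalks
in degrees `j ≥ a`; there the Ext degree `j - c` exceeds `n`. -/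
lemma hom_to_single_eq_zero [HasExt.{w} A] (n : ℕ)
    (hpd : ∀ (M N : A) (i : ℕ), n < i → Subsingleton (Abelian.Ext M N i))
    (X : DerivedCategory A) (a b c : ℤ) [X.IsGE a] [X.IsLE b] (h : c + n < a) (N : A)
    (f : X ⟶ (singleFunctor A c).obj N) : f = 0 := by
  let Φ : ObjectProperty (DerivedCategory A) := fun X =>
    ∀ f : X ⟶ (singleFunctor A c).obj N, f = 0
  refine prop_of_bounded Φ (fun Z hZ f => hZ.eq_of_src _ _) ?_ X a b ?_ ⟨?_⟩ f
  · intro T hT h₁ h₃ f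
    obtain ⟨g, rfl⟩ := T.yoneda_exact₂ hT f (h₁ _)
    rw [h₃ g, comp_zero]
  · intro j hj _ f
    exact single_hom_eq_zero_of_ext _ N j c (j - c).toNat (by lia) (hpd _ _ _ (by lia)) f
  · intro X Y e hX f
    rw [← cancel_epi e.hom, hX (e.hom ≫ f), comp_zero]

lemma hom_from_single_eq_zero [HasExt.{w} A] (n : ℕ)
    (hpd : ∀ (M N : A) (i : ℕ), n < i → Subsingleton (Abelian.Ext M N i))
    (X : DerivedCategory A) (a b c : ℤ) [X.IsGE a] [X.IsLE b] (h : b + n < c) (M : A)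
    (f : (singleFunctor A c).obj M ⟶ X) : f = 0 := by
  let Φ : ObjectProperty (DerivedCategory A) := fun X =>
    ∀ f : (singleFunctor A c).obj M ⟶ X, f = 0
  refine prop_of_bounded Φ (fun Z hZ f => hZ.eq_of_tgt _ _) ?_ X a b ?_ ⟨?_⟩ f
  · intro T hT h₁ h₃ f
    obtain ⟨g, rfl⟩ := T.coyoneda_exact₂ hT f (h₃ _)
    rw [h₁ g, zero_comp]
  · intro j hj _ f
    exact single_hom_eq_zero_of_ext M _ c j (c - j).toNat (by lia) (hpd _ _ _ (by lia)) f
  · intro X Y e hX f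
    rw [← cancel_mono e.inv, hX (f ≫ e.inv), zero_comp]

/-- A morphism from a cohomology object to an injective object lifts to the derived category. -/
lemma exists_hom_to_single_injective (X : DerivedCategory A) (j : ℤ) (I : A) [Injective I]
    (φ : (homologyFunctor A j).obj X ⟶ I) :
    ∃ f : X ⟶ (singleFunctor A j).obj I,
      (homologyFunctor A j).map f ≫ (homologySingleIso I j).hom = φ := by
  obtain ⟨K, ⟨e⟩⟩ : ∃ K, Nonempty (Q.obj K ≅ X) := ⟨_, ⟨Q.objObjPreimageIso X⟩⟩
  let ε := homologyQIso K j
  let φ' : K.homology j ⟶ I := ε.inv ≫ (homologyFunctor A j).map e.hom ≫ φ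
  -- Injectivity extends the morphism along `H^j(K) ↪ K.opcycles j`, and a morphism out of the
  -- opcycles is a chain map to the stalk complex.
  let ψ : K.opcycles j ⟶ I := Injective.factorThru φ' (K.homologyι j)
  have hψ : K.homologyι j ≫ ψ = φ' := Injective.comp_factorThru _ _
  let c : K ⟶ (HomologicalComplex.single A (ComplexShape.up ℤ) j).obj I :=
    HomologicalComplex.mkHomToSingle (K.pOpcycles j ≫ ψ) (by simp)
  have hc : HomologicalComplex.homologyMap c j ≫
      (HomologicalComplex.singleObjHomologySelfIso _ j I).hom = φ' := by
    rw [← hψ, ← HomologicalComplex.homologyι_singleObjOpcyclesSelfIso_inv,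
      HomologicalComplex.homologyι_naturality_assoc]
    congr 1
    rw [← cancel_epi (K.pOpcycles j), HomologicalComplex.p_opcyclesMap_assoc,
      HomologicalComplex.pOpcycles_singleObjOpcyclesSelfIso_inv]
    simp [c]
  refine ⟨e.inv ≫ Q.map c ≫ (singleIsoQ I j).inv, ?_⟩
  have h₂ : (homologyFunctor A j).map (Q.map c) ≫ (homologyQIso _ j).hom ≫
      (HomologicalComplex.singleObjHomologySelfIso _ j I).hom =
      (homologyFunctor A j).map e.hom ≫ φ := by
    rw [← Category.assoc, homologyQIso_hom_naturality, Category.assoc, hc]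
    exact ε.hom_inv_id_assoc _
  simp only [homologySingleIso, Iso.trans_hom, Functor.mapIso_hom,
    ← Functor.map_comp_assoc, Category.assoc, Iso.inv_hom_id, Category.comp_id]
  rw [Functor.map_comp_assoc, h₂, ← Functor.map_comp_assoc, e.inv_hom_id,
    CategoryTheory.Functor.map_id, Category.id_comp]

/-- A morphism from a projective object to a cohomology object lifts to the derived category. -/
lemma exists_hom_from_single_projective (X : DerivedCategory A) (j : ℤ) (P : A) [Projective P]
    (φ : P ⟶ (homologyFunctor A j).obj X) :
    ∃ f : (singleFunctor A j).obj P ⟶ X,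
      (homologySingleIso P j).inv ≫ (homologyFunctor A j).map f = φ := by
  obtain ⟨K, ⟨e⟩⟩ : ∃ K, Nonempty (Q.obj K ≅ X) := ⟨_, ⟨Q.objObjPreimageIso X⟩⟩
  let ε := homologyQIso K j
  let φ' : P ⟶ K.homology j := φ ≫ (homologyFunctor A j).map e.inv ≫ ε.hom
  -- Dually, projectivity lifts the morphism along the surjection from cycles to cohomology.
  let ψ : P ⟶ K.cycles j := Projective.factorThru φ' (K.homologyπ j)
  have hψ : ψ ≫ K.homologyπ j = φ' := Projective.factorThru_comp _ _
  let c : (HomologicalComplex.single A (ComplexShape.up ℤ) j).obj P ⟶ K :=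
    HomologicalComplex.mkHomFromSingle (ψ ≫ K.iCycles j) (by simp)
  have hc : (HomologicalComplex.singleObjHomologySelfIso _ j P).inv ≫
      HomologicalComplex.homologyMap c j = φ' := by
    rw [← hψ, ← HomologicalComplex.singleObjCyclesSelfIso_inv_homologyπ, Category.assoc,
      HomologicalComplex.homologyπ_naturality, ← Category.assoc]
    congr 1
    rw [← cancel_mono (K.iCycles j), Category.assoc, HomologicalComplex.cyclesMap_i]
    simp [c]
  refine ⟨(singleIsoQ P j).hom ≫ Q.map c ≫ e.hom, ?_⟩
  have h₂ : (homologyFunctor A j).map (Q.map c) = (homologyQIso _ j).hom ≫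
      (HomologicalComplex.singleObjHomologySelfIso _ j P).hom ≫
      φ ≫ (homologyFunctor A j).map e.inv := by
    rw [← cancel_mono ε.hom]
    refine (homologyQIso_hom_naturality c j).trans ?_
    simp only [Category.assoc]
    congr 1
    rw [← Iso.inv_comp_eq, hc]
  rw [Iso.inv_comp_eq]
  simp only [homologySingleIso, Iso.trans_hom, Functor.mapIso_hom, Functor.map_comp,
    h₂, Category.assoc]
  rw [← Functor.map_comp, e.inv_hom_id, CategoryTheory.Functor.map_id, Category.comp_id]

/-- Objects whose cohomology is concentrated in degrees divisible by `n` decompose as direct sums of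
their cohomology objects when the global dimension is at most `n`. -/
lemma prop_of_homology_concentrated [HasExt.{w} A] (n : ℕ)
    (hpd : ∀ (M N : A) (i : ℕ), n < i → Subsingleton (Abelian.Ext M N i))
    (Ψ U : ObjectProperty (DerivedCategory A))
    (hΨ : ∀ X Y, Nonempty (Retract X Y) → Ψ Y → Ψ X)
    (hΨ' : ∀ X j, Ψ X → ¬ (n : ℤ) ∣ j → IsZero ((homologyFunctor A j).obj X))
    (hU₀ : ∀ Z, IsZero Z → U Z)
    (hU : ∀ T ∈ distTriang (DerivedCategory A), T.mor₃ = 0 → U T.obj₁ → U T.obj₃ → U T.obj₂)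
    (S : ObjectProperty A) [S.IsClosedUnderIsomorphisms]
    (hS : ∀ N j, S N → (n : ℤ) ∣ j → Ψ ((singleFunctor A j).obj N) →
      U ((singleFunctor A j).obj N))
    (X : DerivedCategory A) (a b : ℤ) [X.IsGE a] [X.IsLE b]
    (hX : ∀ j, a ≤ j → S ((homologyFunctor A j).obj X)) (h : Ψ X) : U X := by
  obtain ⟨m, hm⟩ : ∃ m : ℕ, b < a + m := ⟨(b + 1 - a).toNat, by lia⟩
  induction m generalizing X a with
  | zero => exact hU₀ _ (TStructure.t.isZero X b a (by lia))
  | succ m ih =>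
    by_cases ha : (n : ℤ) ∣ a
    swap
    · have : X.IsGE (a + 1) := by
        rw [isGE_iff]
        intro i hi
        rcases eq_or_lt_of_le (show i ≤ a by lia) with rfl | hi'
        · exact hΨ' X i h ha
        · exact isZero_of_isGE X a i hi'
      exact ih X (a + 1) (fun j hj => hX j (by lia)) h (by push_cast at hm; lia)
    by_cases hab : b < a
    · exact hU₀ _ (TStructure.t.isZero X b a (by lia))
    obtain ⟨X', f, g, δ, mem, hX', hg⟩ := exists_lowest_truncation X a
    have hLE : X'.IsLE b := by
      rw [isLE_iff]
      intro i hi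
      have := hg i (by lia)
      exact (isZero_of_isLE X b i hi).of_iso (asIso ((homologyFunctor A i).map g)).symm
    -- Both `a` and the degrees of the cohomology of `X'` are multiples of `n`, so after `a` the
    -- next possible one is `a + n`.
    have hGE : X'.IsGE (a + n) := by
      rw [isGE_iff]
      intro i hi
      by_cases hi' : i < a + 1
      · exact isZero_of_isGE X' (a + 1) i hi'
      · have := hg i (by lia)
        refine (hΨ' X i h ?_).of_iso (asIso ((homologyFunctor A i).map g)).symm
        rintro ⟨c, rfl⟩
        obtain ⟨d, rfl⟩ := ha
        have h₁ : d < c := by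
          by_contra hc
          have := mul_le_mul_of_nonneg_left (not_lt.1 hc) (Int.natCast_nonneg n)
          lia
        have h₂ := mul_le_mul_of_nonneg_left (show d + 1 ≤ c from h₁) (Int.natCast_nonneg n)
        rw [mul_add] at h₂
        lia
    -- The target of `δ` is a stalk in degree `a - 1`, which is `n + 1` below the lower bound `a +
    -- n` of `X'`.
    have hδ : δ = 0 := by
      rw [← cancel_mono (singleShiftIso _ 1 (a - 1) a (by lia)).hom, zero_comp]
      exact hom_to_single_eq_zero n hpd X' (a + n) b (a - 1) (by lia) _ _
    obtain ⟨s, hs⟩ : ∃ s : X' ⟶ X, s ≫ g = 𝟙 X' := by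
      obtain ⟨s, hs⟩ := Triangle.coyoneda_exact₃ _ mem (𝟙 X')
        (by rw [hδ]; exact comp_zero)
      exact ⟨s, hs.symm⟩
    -- The triangle splits, so both outer terms are retracts of `X` and inherit `Ψ`.
    obtain ⟨r, hr⟩ : ∃ r, f ≫ r = 𝟙 _ := by
      have : Mono f := Triangle.mono₁ _ mem hδ
      obtain ⟨r, hr⟩ : ∃ r : X ⟶ (singleFunctor A a).obj _, 𝟙 X - g ≫ s = r ≫ f :=
        Triangle.coyoneda_exact₂ _ mem (𝟙 X - g ≫ s) (by
          change (𝟙 X - g ≫ s) ≫ g = 0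
          rw [Preadditive.sub_comp, Category.assoc, hs, Category.id_comp, Category.comp_id,
            sub_self])
      have hfg : f ≫ g = 0 := comp_distTriang_mor_zero₁₂ _ mem
      refine ⟨r, ?_⟩
      rw [← cancel_mono f, Category.assoc, ← hr, Preadditive.comp_sub, reassoc_of% hfg, zero_comp,
        sub_zero, Category.comp_id, Category.id_comp]
    refine hU _ mem hδ (hS _ a (hX a le_rfl) ha (hΨ _ X ⟨⟨f, r, hr⟩⟩ h)) ?_
    refine ih X' (a + 1) (fun j hj => ?_) (hΨ _ X ⟨⟨s, g, hs⟩⟩ h) (by push_cast at hm; lia)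
    have := hg j (by lia)
    exact S.prop_of_iso (asIso ((homologyFunctor A j).map g)) (hX j (by lia))

end Derived

/-! ### Finitely generated projective and injective modules -/

section FiniteModules

lemma injective_moduleCat_field (k : Type w) [Field k] (V : ModuleCat.{v} k) : Injective V where
  factors {X Y} g f hf := by
    obtain ⟨l, hl⟩ := f.hom.exists_leftInverse_of_injective
      (LinearMap.ker_eq_bot.2 ((ModuleCat.mono_iff_injective f).1 hf))
    refine ⟨ModuleCat.ofHom (g.hom ∘ₗ l), ?_⟩
    ext x
    have : l (f.hom x) = x := LinearMap.congr_fun hl x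
    simp [this]

variable {R : Type u} [Ring R]

/-- Finitely generated modules over a finite dimensional algebra embed into finitely generated
injective modules. -/
lemma exists_mono_to_finite_injective (k : Type w) [Field k] [Algebra k R] [Module.Finite k R]
    (M : ModuleCat.{u} R) [Module.Finite R M] :
    ∃ (I : ModuleCat.{u} R) (i : M ⟶ I), Module.Finite R I ∧ Injective I ∧ Mono i := by
  let f := algebraMap k R
  let adj := ModuleCat.restrictCoextendScalarsAdj.{u} f
  let N := (ModuleCat.restrictScalars f).obj M
  refine ⟨(ModuleCat.coextendScalars f).obj N, adj.unit.app M, ?_, ?_, ?_⟩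
  · let : Module k M := Module.compHom M f
    have : IsScalarTower k R M := ⟨fun a r m => by
      rw [Algebra.smul_def, mul_smul]; rfl⟩
    have : Module.Finite k M := Module.Finite.trans R M
    have : Module.Finite k N := inferInstanceAs (Module.Finite k M)
    have hR : Module.Finite k ((ModuleCat.restrictScalars f).obj (ModuleCat.of R R)) := by
      refine Module.Finite.equiv (M := R)
        { toFun := id, invFun := id, map_add' := fun _ _ => rfl, left_inv := fun _ => rfl,
          right_inv := fun _ => rfl, map_smul' := fun a x => Algebra.smul_def a x }
    -- `R` acts on `Hom_k(R, N)` by `(r g)(s) = g(s r)`; compatibility with `k` uses that scalars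
    -- are central in `R`.
    have : IsScalarTower k R ((ModuleCat.restrictScalars f).obj (ModuleCat.of R R) →ₗ[k] N) :=
      ⟨fun a r g => by
        refine LinearMap.ext fun (s : R) => ?_
        have h : ∀ x : R, g (f a * x : R) = a • g x := fun x => g.map_smul a x
        change g (s * (a • r) : R) = a • g (s * r : R)
        rw [mul_smul_comm, Algebra.smul_def, h]⟩
    have hfin : Module.Finite R ((ModuleCat.restrictScalars f).obj (ModuleCat.of R R) →ₗ[k] N) :=
      Module.Finite.of_restrictScalars_finite k R _
    exact Module.Finite.equiv (ModuleCat.CoextendScalars.equiv f N).symm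
  · have := injective_moduleCat_field k N
    exact Injective.injective_of_adjoint adj N
  · rw [ModuleCat.mono_iff_injective]
    intro x y hxy
    have h : ∀ z : M, ModuleCat.CoextendScalars.equiv f N ((adj.unit.app M).hom z) (1 : R) = z :=
      fun z => one_smul R z
    rw [← h x, ← h y, hxy]

lemma exists_epi_from_finite_projective (M : ModuleCat.{u} R) [Module.Finite R M] :
    ∃ (P : ModuleCat.{u} R) (p : P ⟶ M), Module.Finite R P ∧ Projective P ∧ Epi p := by
  obtain ⟨m, f, hf⟩ := Module.Finite.exists_fin' R M
  exact ⟨ModuleCat.of R (Fin m → R), ModuleCat.ofHom f,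
    inferInstanceAs (Module.Finite R (Fin m → R)),
    ModuleCat.projective_of_categoryTheory_projective _, (ModuleCat.epi_iff_surjective _).2 hf⟩

variable (R) in
lemma isNoetherianRing_of_finite (k : Type w) [Field k] [Algebra k R] [Module.Finite k R] :
    IsNoetherianRing R :=
  isNoetherian_of_tower k (inferInstance : IsNoetherian k R)

/-- Positive Ext groups out of a projective vanish. This supplies the test objects in `C` that
detect cohomology. -/
lemma mem_of_projective {n : ℕ} {C : ObjectProperty (FGModuleCat.{u} R)}
    (hC : IsModuleClusterTilting n C) (P : FGModuleCat.{u} R) (hP : Projective P.obj) : C P := by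
  refine (hC.iff_left P).2 fun Y _ i hi _ => ⟨fun a b => ?_⟩
  obtain ⟨i, rfl⟩ := Nat.exists_eq_succ_of_ne_zero hi.ne'
  rw [Abelian.Ext.eq_zero_of_projective a, Abelian.Ext.eq_zero_of_projective b]

lemma mem_of_injective {n : ℕ} {C : ObjectProperty (FGModuleCat.{u} R)}
    (hC : IsModuleClusterTilting n C) (I : FGModuleCat.{u} R) (hI : Injective I.obj) : C I := by
  refine (hC.iff_right I).2 fun Y _ i hi _ => ⟨fun a b => ?_⟩
  obtain ⟨i, rfl⟩ := Nat.exists_eq_succ_of_ne_zero hi.ne'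
  rw [Abelian.Ext.eq_zero_of_injective a, Abelian.Ext.eq_zero_of_injective b]

lemma hasProjectiveDimensionLE_of_globalDimension_le {n : ℕ} (h : globalDimension R ≤ n)
    (M : ModuleCat.{u} R) : HasProjectiveDimensionLE M n :=
  (projectiveDimension_le_iff M n).1 ((le_iSup (fun M => projectiveDimension M) M).trans h)

end FiniteModules

/-! ### Bounded complexes of projectives inside the derived category -/

section BoundedProjective

open Pretriangulated DerivedCategory

variable {R : Type u} [Ring R]

lemma boundedProj_mappingCone {K L : CochainComplex (ModuleCat.{u} R) ℤ} (f : K ⟶ L)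
    (hK : boundedProj R K) (hL : boundedProj R L) :
    boundedProj R (CochainComplex.mappingCone f) := by
  obtain ⟨⟨a, b, _, _⟩, hK'⟩ := hK
  obtain ⟨⟨a', b', _, _⟩, hL'⟩ := hL
  refine ⟨⟨min (a - 1) a', max b b', ?_, ?_⟩, fun i => ?_⟩
  · rw [CochainComplex.isStrictlyGE_iff]
    intro i hi
    rw [CochainComplex.mappingCone.isZero_X_iff]
    exact ⟨K.isZero_of_isStrictlyGE a _ (by lia), L.isZero_of_isStrictlyGE a' _ (by lia)⟩
  · rw [CochainComplex.isStrictlyLE_iff]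
    intro i hi
    rw [CochainComplex.mappingCone.isZero_X_iff]
    exact ⟨K.isZero_of_isStrictlyLE b _ (by lia), L.isZero_of_isStrictlyLE b' _ (by lia)⟩
  · obtain ⟨h₁, h₂⟩ := hK' (i + 1)
    obtain ⟨h₃, h₄⟩ := hL' i
    let e : (CochainComplex.mappingCone f).X i ≅ ModuleCat.of R (K.X (i + 1) × L.X i) :=
      HomologicalComplex.homotopyCofiber.XIsoBiprod f i (i + 1) rfl ≪≫
        ModuleCat.biprodIsoProd _ _
    exact ⟨Module.Finite.equiv e.toLinearEquiv.symm,
      Module.Projective.of_equiv e.toLinearEquiv.symm⟩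

instance : (homotopyBoundedProj R).IsTriangulatedClosed₃ where
  ext₃' T hT h₁ h₂ := by
    obtain ⟨f, hf⟩ : ∃ f : T.obj₁.as ⟶ T.obj₂.as,
      (HomotopyCategory.quotient _ _).map f = T.mor₁ :=
      (HomotopyCategory.quotient _ _).map_surjective T.mor₁
    refine ⟨(HomotopyCategory.quotient _ _).obj (CochainComplex.mappingCone f),
      boundedProj_mappingCone f h₁ h₂, ⟨?_⟩⟩
    exact Triangle.π₃.mapIso (isoTriangleOfIso₁₂ T _ hT
      (HomotopyCategory.mappingCone_triangleh_distinguished f) (Iso.refl _) (Iso.refl _)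
      ((Category.comp_id _).trans (hf.symm.trans (Category.id_comp _).symm)))

instance : (homotopyBoundedProj R).ContainsZero where
  exists_zero := by
    obtain ⟨Z, hZ⟩ := HasZeroObject.zero (C := CochainComplex (ModuleCat.{u} R) ℤ)
    have hz (i : ℤ) : IsZero (Z.X i) := (HomologicalComplex.eval _ _ i).map_isZero hZ
    refine ⟨(HomotopyCategory.quotient _ _).obj Z, (HomotopyCategory.quotient _ _).map_isZero hZ,
      ⟨0, 0, (Z.isStrictlyGE_iff 0).2 fun i _ => hz i, (Z.isStrictlyLE_iff 0).2 fun i _ => hz i⟩,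
      fun i => ?_⟩
    have := ModuleCat.subsingleton_of_isZero (hz i)
    change Module.Finite R (Z.X i) ∧ Module.Projective R (Z.X i)
    exact ⟨inferInstance, inferInstance⟩

instance : (homotopyBoundedProj R).IsTriangulated where
  toIsTriangulatedClosed₂ := .of_isTriangulatedClosed₃

lemma isKProjective_of_boundedProj {K : CochainComplex (ModuleCat.{u} R) ℤ}
    (hK : boundedProj R K) : K.IsKProjective := by
  obtain ⟨⟨a, b, _, _⟩, hK'⟩ := hK
  have (i : ℤ) : Projective (K.X i) := by
    have := (hK' i).2
    exact ModuleCat.projective_of_categoryTheory_projective _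
  exact CochainComplex.isKProjective_of_projective K b

lemma finite_of_mono [IsNoetherianRing R] {M N : ModuleCat.{u} R} (f : M ⟶ N) [Mono f]
    (hN : Module.Finite R N) : Module.Finite R M :=
  Module.Finite.of_injective f.hom ((ModuleCat.mono_iff_injective f).1 inferInstance)

lemma finite_of_epi {M N : ModuleCat.{u} R} (f : M ⟶ N) [Epi f]
    (hM : Module.Finite R M) : Module.Finite R N :=
  Module.Finite.of_surjective f.hom ((ModuleCat.epi_iff_surjective f).1 inferInstance)

lemma finite_of_exact [IsNoetherianRing R] {S : ShortComplex (ModuleCat.{u} R)} (hS : S.Exact)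
    (h₁ : Module.Finite R S.X₁) (h₃ : Module.Finite R S.X₃) : Module.Finite R S.X₂ := by
  have := isNoetherian_of_isNoetherianRing_of_finite R S.X₁
  have := isNoetherian_of_isNoetherianRing_of_finite R S.X₃
  have := isNoetherian_of_range_eq_ker S.f.hom S.g.hom hS.moduleCat_range_eq_ker
  infer_instance

universe w'

variable [HasDerivedCategory.{w'} (ModuleCat.{u} R)]

variable (R) in
/-- The functor from `K^b(proj R)` to the derived category of `R`-modules. -/
noncomputable abbrev toDerived : Kb R ⥤ DerivedCategory (ModuleCat.{u} R) :=
  (homotopyBoundedProj R).ι ⋙ Qh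

/-- Bounded complexes of projectives are K-projective. The target is left arbitrary so that stalk
complexes of non-projective modules are allowed. -/
lemma toDerived_map_bijective (X : Kb R) (Y : HomotopyCategory (ModuleCat.{u} R) (.up ℤ)) :
    Function.Bijective (Qh.map : (X.obj ⟶ Y) → _) := by
  have := isKProjective_of_boundedProj X.property
  exact CochainComplex.IsKProjective.Qh_map_bijective X.obj.as Y

instance : (toDerived R).Full where
  map_surjective {X Y} f := by
    obtain ⟨g, hg⟩ := (toDerived_map_bijective X Y.obj).2 f
    exact ⟨ObjectProperty.homMk g, hg⟩

instance : (toDerived R).Faithful where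
  map_injective {X Y} f g h := by
    ext
    exact (toDerived_map_bijective X Y.obj).1 h

/-- The image of an object of `K^b(proj R)` in the derived category, as the image of a complex. -/
noncomputable def toDerivedIsoQ (P : Kb R) : (toDerived R).obj P ≅ Q.obj P.obj.as :=
  (quotientCompQhIso (ModuleCat.{u} R)).app P.obj.as

lemma exists_isGE_isLE (P : Kb R) :
    ∃ a b : ℤ, ((toDerived R).obj P).IsGE a ∧ ((toDerived R).obj P).IsLE b := by
  obtain ⟨⟨a, b, _, _⟩, -⟩ := P.property
  exact ⟨a, b, TStructure.t.isGE_of_iso (toDerivedIsoQ P).symm a,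
    TStructure.t.isLE_of_iso (toDerivedIsoQ P).symm b⟩

lemma finite_homology_toDerived [IsNoetherianRing R] (P : Kb R) (j : ℤ) :
    Module.Finite R ((homologyFunctor (ModuleCat.{u} R) j).obj ((toDerived R).obj P)) := by
  have h₁ := finite_of_mono (P.obj.as.iCycles j) (P.property.2 j).1
  have h₂ := finite_of_epi (P.obj.as.homologyπ j) h₁
  exact finite_of_mono ((homologyFunctor _ j).mapIso (toDerivedIsoQ P) ≪≫
    homologyQIso P.obj.as j).hom h₂

lemma represents_iff (P : Kb R) (X : FGModuleCat.{u} R) :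
    Represents P X ↔
      Nonempty ((toDerived R).obj P ≅ (singleFunctor (ModuleCat.{u} R) 0).obj X.obj) := by
  constructor
  · rintro ⟨f, hf⟩
    exact ⟨toDerivedIsoQ P ≪≫ asIso (Q.map f) ≪≫ (singleIsoQ X.obj 0).symm⟩
  · rintro ⟨e⟩
    obtain ⟨g, hg⟩ := (toDerived_map_bijective P ((HomotopyCategory.quotient _ _).obj
      ((CochainComplex.singleFunctor (ModuleCat.{u} R) 0).obj X.obj))).2 e.hom
    obtain ⟨f, hf⟩ : ∃ f : P.obj.as ⟶ _, (HomotopyCategory.quotient _ _).map f = g :=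
      (HomotopyCategory.quotient _ _).map_surjective g
    refine ⟨f, ?_⟩
    rw [← isIso_Q_map_iff_quasiIso]
    have h₁ : IsIso (Qh.map g) := by
      rw [hg]
      exact e.isIso_hom
    rw [← hf] at h₁
    exact (NatIso.isIso_map_iff (quotientCompQhIso (ModuleCat.{u} R)) f).1 h₁

/-- By fullness the first morphism of the triangle lifts to `Kb R`, and its cone there maps to the
third vertex. -/
lemma exists_iso_toDerived_obj₃ (T : Triangle (DerivedCategory (ModuleCat.{u} R)))
    (hT : T ∈ distTriang _) (h₁ : ∃ P : Kb R, Nonempty ((toDerived R).obj P ≅ T.obj₁))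
    (h₂ : ∃ P : Kb R, Nonempty ((toDerived R).obj P ≅ T.obj₂)) :
    ∃ P : Kb R, Nonempty ((toDerived R).obj P ≅ T.obj₃) := by
  obtain ⟨P, ⟨e⟩⟩ := h₁
  obtain ⟨P', ⟨e'⟩⟩ := h₂
  obtain ⟨f, hf⟩ := (toDerived R).map_surjective (e.hom ≫ T.mor₁ ≫ e'.inv)
  obtain ⟨P'', g, h, mem⟩ := distinguished_cocone_triangle f
  refine ⟨P'', ⟨Triangle.π₃.mapIso (isoTriangleOfIso₁₂ ((toDerived R).mapTriangle.obj _) T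
    ((toDerived R).map_distinguished _ mem) hT e e' ?_)⟩⟩
  change (toDerived R).map f ≫ e'.hom = e.hom ≫ T.mor₁
  rw [hf, Category.assoc, Category.assoc, e'.inv_hom_id, Category.comp_id]

/-- Induction on projective dimension: the kernel of a finitely generated projective cover map has
smaller dimension, and the module is the cone of the inclusion of that kernel. -/
lemma exists_iso_single [IsNoetherianRing R] (d : ℕ) (M : ModuleCat.{u} R)
    (hM : Module.Finite R M) (h : HasProjectiveDimensionLE M d) :
    ∃ P : Kb R, Nonempty ((toDerived R).obj P ≅ (singleFunctor (ModuleCat.{u} R) 0).obj M) := by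
  have base (M : ModuleCat.{u} R) (hM : Module.Finite R M) (hP : Projective M) :
      ∃ P : Kb R, Nonempty ((toDerived R).obj P ≅
        (singleFunctor (ModuleCat.{u} R) 0).obj M) := by
    let S : CochainComplex (ModuleCat.{u} R) ℤ :=
      (HomologicalComplex.single (ModuleCat.{u} R) (ComplexShape.up ℤ) 0).obj M
    have hz (i : ℤ) (hi : i ≠ 0) : IsZero (S.X i) :=
      HomologicalComplex.isZero_single_obj_X _ _ _ _ hi
    have hS : boundedProj R S := by
      refine ⟨⟨0, 0, (S.isStrictlyGE_iff 0).2 fun i hi => hz i (by lia),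
        (S.isStrictlyLE_iff 0).2 fun i hi => hz i (by lia)⟩, fun i => ?_⟩
      by_cases hi : i = 0
      · subst hi
        have e := (HomologicalComplex.singleObjXSelf (ComplexShape.up ℤ) 0 M).toLinearEquiv
        have : Module.Projective R M := (IsProjective.iff_projective M).2 hP
        exact ⟨Module.Finite.equiv e.symm, Module.Projective.of_equiv e.symm⟩
      · have := ModuleCat.subsingleton_of_isZero (hz i hi)
        exact ⟨inferInstance, inferInstance⟩
    exact ⟨⟨(HomotopyCategory.quotient _ _).obj S, hS⟩, ⟨toDerivedIsoQ _ ≪≫ (singleIsoQ M 0).symm⟩⟩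
  induction d generalizing M with
  | zero => exact base M hM ((projective_iff_hasProjectiveDimensionLE_zero M).2 h)
  | succ d ih =>
    obtain ⟨P, p, hP₁, hP₂, hP₃⟩ := exists_epi_from_finite_projective M
    let S : ShortComplex (ModuleCat.{u} R) := ShortComplex.mk (kernel.ι p) p (kernel.condition p)
    have hS : S.ShortExact := { exact := ShortComplex.exact_kernel p }
    refine exists_iso_toDerived_obj₃ _ hS.singleTriangle_distinguished (ih (kernel p)
      (finite_of_mono (kernel.ι p) hP₁) ?_) (base P hP₁ hP₂)
    exact (hS.hasProjectiveDimensionLT_X₃_iff d hP₂).1 h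

lemma exists_iso_single_of_shifts {n : ℕ} {C : ObjectProperty (FGModuleCat.{u} R)} {Y : Kb R}
    (hY : shifts n C Y) : ∃ (X : FGModuleCat.{u} R) (ℓ : ℤ), C X ∧
      Nonempty ((toDerived R).obj Y ≅ (singleFunctor (ModuleCat.{u} R) (-(ℓ * n))).obj X.obj) := by
  obtain ⟨X, P, ℓ, hX, hP, ⟨e⟩⟩ := hY
  obtain ⟨e'⟩ := (represents_iff P X).1 hP
  exact ⟨X, ℓ, hX, ⟨(toDerived R).mapIso e ≪≫ ((toDerived R).commShiftIso _).app P ≪≫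
    (shiftFunctor _ _).mapIso e' ≪≫ singleShiftIso X.obj _ _ _ (by lia)⟩⟩

end BoundedProjective

/-! ### Additive closures and approximations by them -/

section AdditiveClosure

variable {T : Type u} [Category.{v} T] [Preadditive T] {S : ObjectProperty T}

/-- With the converse `add_of_sum_eq_id`, this encodes membership in `add S` by a decomposition of
the identity, which suits arguments made one summand at a time. -/
lemma exists_sum_eq_id_of_add {X : T} (hX : add S X) :
    ∃ (m : ℕ) (Y : Fin m → T) (i : ∀ j, X ⟶ Y j) (p : ∀ j, Y j ⟶ X),
      (∀ j, S (Y j)) ∧ ∑ j, i j ≫ p j = 𝟙 X := by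
  obtain ⟨m, Y, b, hY, ⟨hb⟩, ⟨r⟩⟩ := hX
  refine ⟨m, Y, fun j => r.i ≫ b.π j, fun j => b.ι j ≫ r.r, hY, ?_⟩
  have h := IsBilimit.total hb
  calc ∑ j, (r.i ≫ b.π j) ≫ b.ι j ≫ r.r = r.i ≫ (∑ j, b.π j ≫ b.ι j) ≫ r.r := by
        simp [Preadditive.comp_sum, Preadditive.sum_comp]
    _ = 𝟙 X := by rw [h, Category.id_comp, r.retract]

lemma add_of_sum_eq_id [HasFiniteBiproducts T] {X : T} {J : Type} [Fintype J] (Y : J → T)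
    (i : ∀ j, X ⟶ Y j) (p : ∀ j, Y j ⟶ X) (hY : ∀ j, S (Y j)) (h : ∑ j, i j ≫ p j = 𝟙 X) :
    add S X := by
  let e := Fintype.equivFin J
  refine ⟨Fintype.card J, fun j => Y (e.symm j), biproduct.bicone _, fun j => hY _,
    ⟨biproduct.isBilimit _⟩, ⟨biproduct.lift fun j => i (e.symm j),
      biproduct.desc fun j => p (e.symm j), ?_⟩⟩
  rw [← h, ← e.symm.sum_comp]
  exact biproduct.lift_desc

lemma add_of_isZero [HasFiniteBiproducts T] {X : T} (hX : IsZero X) : add S X :=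
  add_of_sum_eq_id (J := Fin 0) (fun _ => X) (fun _ => 0) (fun _ => 0) (fun j => j.elim0)
    (hX.eq_of_src _ _)

lemma add_of_mem [HasFiniteBiproducts T] {X : T} (hX : S X) : add S X :=
  add_of_sum_eq_id (J := Fin 1) (fun _ => X) (fun _ => 𝟙 X) (fun _ => 𝟙 X) (fun _ => hX) (by simp)

lemma add_of_split [HasFiniteBiproducts T] {X A B : T} (hA : add S A) (hB : add S B)
    (iA : X ⟶ A) (pA : A ⟶ X) (iB : X ⟶ B) (pB : B ⟶ X) (h : iA ≫ pA + iB ≫ pB = 𝟙 X) :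
    add S X := by
  obtain ⟨m, Y, i, p, hY, hs⟩ := exists_sum_eq_id_of_add hA
  obtain ⟨m', Y', i', p', hY', hs'⟩ := exists_sum_eq_id_of_add hB
  refine add_of_sum_eq_id (J := Fin m ⊕ Fin m') (Sum.elim Y Y')
    (fun j => match j with
      | .inl j => iA ≫ i j
      | .inr j => iB ≫ i' j)
    (fun j => match j with
      | .inl j => p j ≫ pA
      | .inr j => p' j ≫ pB)
    (fun j => match j with
      | .inl j => hY j
      | .inr j => hY' j) ?_
  rw [Fintype.sum_sum_type, ← h]
  congr 1
  · calc _ = iA ≫ (∑ j, i j ≫ p j) ≫ pA := by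
          simp [Preadditive.comp_sum, Preadditive.sum_comp]
      _ = _ := by rw [hs, Category.id_comp]
  · calc _ = iB ≫ (∑ j, i' j ≫ p' j) ≫ pB := by
          simp [Preadditive.comp_sum, Preadditive.sum_comp]
      _ = _ := by rw [hs', Category.id_comp]

lemma hom_eq_zero_of_add {X Y : T} (hX : add S X) (hY : add S Y) (F : T ⥤ T) [F.Additive]
    (h : ∀ X' Y', S X' → S Y' → ∀ f : X' ⟶ F.obj Y', f = 0) (f : X ⟶ F.obj Y) : f = 0 := by
  obtain ⟨m, Z, i, p, hZ, hs⟩ := exists_sum_eq_id_of_add hX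
  obtain ⟨m', Z', i', p', hZ', hs'⟩ := exists_sum_eq_id_of_add hY
  calc f = (∑ j, i j ≫ p j) ≫ f ≫ F.map (∑ j, i' j ≫ p' j) := by simp [hs, hs']
    _ = 0 := by
      simp only [Preadditive.sum_comp, Functor.map_sum, Preadditive.comp_sum, Functor.map_comp,
        Category.assoc]
      refine Finset.sum_eq_zero fun j' _ => Finset.sum_eq_zero fun j _ => ?_
      have := h _ _ (hZ j) (hZ' j') (p j ≫ f ≫ F.map (i' j'))
      simp only [← Category.assoc] at this ⊢
      rw [Category.assoc (i j), Category.assoc (i j), this, comp_zero, zero_comp]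

/-- Finitely many partial approximations are combined by mapping to the biproduct of their targets.
-/
lemma exists_left_approximation_of_finset [HasFiniteBiproducts T] (L : ℤ → ObjectProperty T)
    (X : T) (s : Finset ℤ)
    (h : ∀ l ∈ s, ∃ (A : T) (f : X ⟶ A), add S A ∧ ∀ Y, L l Y → ∀ g : X ⟶ Y, ∃ h, f ≫ h = g) :
    ∃ (A : T) (f : X ⟶ A), add S A ∧ ∀ l ∈ s, ∀ Y, L l Y → ∀ g : X ⟶ Y, ∃ h, f ≫ h = g := by
  have := hasBinaryBiproducts_of_finite_biproducts T
  induction s using Finset.induction_on with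
  | empty =>
    obtain ⟨Z, hZ⟩ := HasZeroObject.zero (C := T)
    exact ⟨Z, 0, add_of_isZero hZ, by simp⟩
  | insert l s hl ih =>
    obtain ⟨A, f, hA, hf⟩ := ih fun l hl => h l (Finset.mem_insert_of_mem hl)
    obtain ⟨A', f', hA', hf'⟩ := h l (Finset.mem_insert_self _ _)
    refine ⟨A ⊞ A', biprod.lift f f', add_of_split hA hA' biprod.fst biprod.inl biprod.snd
      biprod.inr biprod.total, fun l' hl' Y hY g => ?_⟩
    rcases Finset.mem_insert.1 hl' with rfl | hl'
    · obtain ⟨t, rfl⟩ := hf' Y hY g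
      exact ⟨biprod.snd ≫ t, by simp⟩
    · obtain ⟨t, rfl⟩ := hf l' hl' Y hY g
      exact ⟨biprod.fst ≫ t, by simp⟩

lemma exists_right_approximation_of_finset [HasFiniteBiproducts T] (L : ℤ → ObjectProperty T)
    (X : T) (s : Finset ℤ)
    (h : ∀ l ∈ s, ∃ (A : T) (f : A ⟶ X), add S A ∧ ∀ Y, L l Y → ∀ g : Y ⟶ X, ∃ h, h ≫ f = g) :
    ∃ (A : T) (f : A ⟶ X), add S A ∧ ∀ l ∈ s, ∀ Y, L l Y → ∀ g : Y ⟶ X, ∃ h, h ≫ f = g := by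
  have := hasBinaryBiproducts_of_finite_biproducts T
  induction s using Finset.induction_on with
  | empty =>
    obtain ⟨Z, hZ⟩ := HasZeroObject.zero (C := T)
    exact ⟨Z, 0, add_of_isZero hZ, by simp⟩
  | insert l s hl ih =>
    obtain ⟨A, f, hA, hf⟩ := ih fun l hl => h l (Finset.mem_insert_of_mem hl)
    obtain ⟨A', f', hA', hf'⟩ := h l (Finset.mem_insert_self _ _)
    refine ⟨A ⊞ A', biprod.desc f f', add_of_split hA hA' biprod.fst biprod.inl biprod.snd
      biprod.inr biprod.total, fun l' hl' Y hY g => ?_⟩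
    rcases Finset.mem_insert.1 hl' with rfl | hl'
    · obtain ⟨t, rfl⟩ := hf' Y hY g
      exact ⟨t ≫ biprod.inr, by simp⟩
    · obtain ⟨t, rfl⟩ := hf l' hl' Y hY g
      exact ⟨t ≫ biprod.inl, by simp⟩

lemma left_approximation_add {X A : T} (f : X ⟶ A)
    (hf : ∀ Y, S Y → ∀ g : X ⟶ Y, ∃ h, f ≫ h = g) (Y : T) (hY : add S Y) (g : X ⟶ Y) :
    ∃ h, f ≫ h = g := by
  obtain ⟨m, Z, i, p, hZ, hs⟩ := exists_sum_eq_id_of_add hY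
  choose t ht using fun j => hf (Z j) (hZ j) (g ≫ i j)
  refine ⟨∑ j, t j ≫ p j, ?_⟩
  rw [Preadditive.comp_sum]
  simp only [reassoc_of% ht]
  rw [← Preadditive.comp_sum, hs, Category.comp_id]

lemma right_approximation_add {X A : T} (f : A ⟶ X)
    (hf : ∀ Y, S Y → ∀ g : Y ⟶ X, ∃ h, h ≫ f = g) (Y : T) (hY : add S Y) (g : Y ⟶ X) :
    ∃ h, h ≫ f = g := by
  obtain ⟨m, Z, i, p, hZ, hs⟩ := exists_sum_eq_id_of_add hY
  choose t ht using fun j => hf (Z j) (hZ j) (p j ≫ g)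
  refine ⟨∑ j, i j ≫ t j, ?_⟩
  simp only [Preadditive.sum_comp, Category.assoc, ht]
  simp only [← Category.assoc]
  rw [← Preadditive.sum_comp, hs, Category.id_comp]

end AdditiveClosure

/-! ### Weakly universal morphisms to and from stalk complexes -/

section Approximations

open Pretriangulated DerivedCategory

universe w'

variable {R : Type u} [Ring R] [HasDerivedCategory.{w'} (ModuleCat.{u} R)]

/-- Morphisms from a bounded complex of projectives to the stalk complexes in a given degree factor
through a universal one. -/
lemma exists_universal_hom_to_single (X : Kb R) (j : ℤ) :
    ∃ (W : ModuleCat.{u} R) (π : (toDerived R).obj X ⟶ (singleFunctor (ModuleCat.{u} R) j).obj W),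
      Module.Finite R W ∧ ∀ (N : ModuleCat.{u} R)
        (g : (toDerived R).obj X ⟶ (singleFunctor (ModuleCat.{u} R) j).obj N),
        ∃ h : W ⟶ N, π ≫ (singleFunctor (ModuleCat.{u} R) j).map h = g := by
  let K : CochainComplex (ModuleCat.{u} R) ℤ := X.obj.as
  let c : K ⟶ (HomologicalComplex.single (ModuleCat.{u} R) (ComplexShape.up ℤ) j).obj
    (K.opcycles j) := HomologicalComplex.mkHomToSingle (K.pOpcycles j) (by simp)
  refine ⟨K.opcycles j, Qh.map ((HomotopyCategory.quotient _ _).map c),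
    finite_of_epi (K.pOpcycles j) (X.property.2 j).1, fun N g => ?_⟩
  obtain ⟨g', rfl⟩ := (toDerived_map_bijective X ((HomotopyCategory.quotient _ _).obj
      ((HomologicalComplex.single (ModuleCat.{u} R) (ComplexShape.up ℤ) j).obj N))).2 g
  obtain ⟨f, rfl⟩ : ∃ f : K ⟶ _, (HomotopyCategory.quotient _ _).map f = g' :=
      (HomotopyCategory.quotient _ _).map_surjective g'
  -- A chain map to a stalk complex in degree `j` kills the incoming boundaries, hence factors
  -- through the opcycles.
  let h : K.opcycles j ⟶ N := K.descOpcycles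
    (f.f j ≫ (HomologicalComplex.singleObjXSelf (ComplexShape.up ℤ) j N).hom) (j - 1) (by simp)
    (by rw [← f.comm_assoc]; simp)
  have hc : c ≫ (HomologicalComplex.single (ModuleCat.{u} R) (ComplexShape.up ℤ) j).map h = f := by
    apply HomologicalComplex.to_single_hom_ext
    simp [c, h, HomologicalComplex.single_map_f_self]
  refine ⟨h, ?_⟩
  rw [← hc]
  exact (Qh.map_comp _ _).symm.trans (congrArg Qh.map (Functor.map_comp _ _ _).symm)

variable [IsNoetherianRing R]

/-- Morphisms from the stalk complexes in a given degree to an object with finitely generated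
cohomology factor through a universal one. -/
lemma exists_universal_hom_from_single
    (hinj : ∀ M : ModuleCat.{u} R, Module.Finite R M →
      ∃ (I : ModuleCat.{u} R) (i : M ⟶ I), Module.Finite R I ∧ Injective I ∧ Mono i)
    (X : DerivedCategory (ModuleCat.{u} R)) (a j : ℤ) [X.IsGE a]
    (hX : ∀ i, Module.Finite R ((homologyFunctor (ModuleCat.{u} R) i).obj X)) :
    ∃ (Z : ModuleCat.{u} R) (ι : (singleFunctor (ModuleCat.{u} R) j).obj Z ⟶ X),
      Module.Finite R Z ∧ ∀ (M : ModuleCat.{u} R)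
        (g : (singleFunctor (ModuleCat.{u} R) j).obj M ⟶ X),
        ∃ h : M ⟶ Z, (singleFunctor (ModuleCat.{u} R) j).map h ≫ ι = g := by
  obtain ⟨m, hm⟩ : ∃ m : ℕ, j ≤ a + m := ⟨(j - a).toNat, by lia⟩
  induction m generalizing X a with
  | zero =>
    -- When `X` lives in degrees at least `j`, the lowest truncation `H^j(X)[-j] ⟶ X` is universal:
    -- the other vertex lives in degrees above `j`.
    have : X.IsGE j := TStructure.t.isGE_of_ge X j a (by lia)
    obtain ⟨X', f, g, δ, mem, hX', -⟩ := exists_lowest_truncation X j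
    refine ⟨_, f, hX j, fun M t => ?_⟩
    obtain ⟨s, hs⟩ : ∃ s : _ ⟶ (singleFunctor (ModuleCat.{u} R) j).obj _, t = s ≫ f :=
      Triangle.coyoneda_exact₂ _ mem t
        (TStructure.t.zero (t ≫ g) j (j + 1) (by lia))
    obtain ⟨h, rfl⟩ := (singleFunctor (ModuleCat.{u} R) j).map_surjective s
    exact ⟨h, hs.symm⟩
  | succ m ih =>
    by_cases hja : j ≤ a
    · exact ih X a hX (by lia)
    -- For `a < j`, the lowest cohomology is removed by passing to the cocone of `X ⟶ I[-a]`. Stalks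
    -- in degree `j` still lift to it, as Ext of degree `j - a > 0` into `I` vanishes.
    obtain ⟨I, φ, hI₁, hI₂, hI₃⟩ := hinj _ (hX a)
    obtain ⟨f, hf⟩ := exists_hom_to_single_injective X a I φ
    obtain ⟨X', g, δ, mem⟩ := distinguished_cocone_triangle₁ f
    have hmono (i : ℤ) (hi : i ≤ a) : Mono ((homologyFunctor (ModuleCat.{u} R) i).map g) :=
      (HomologySequence.mono_homologyMap_mor₁_iff _ mem (i - 1) i).2
        ((isZero_homology_single I (show i - 1 ≠ a by lia)).eq_of_src _ _)
    have : X'.IsGE (a + 1) := by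
      rw [isGE_iff]
      intro i hi
      have := hmono i (by lia)
      rcases eq_or_lt_of_le (show i ≤ a by lia) with rfl | hi'
      · have h₁ : Mono ((homologyFunctor (ModuleCat.{u} R) i).map f) := mono_of_mono_fac hf
        have h₂ : g ≫ f = 0 := comp_distTriang_mor_zero₁₂ _ mem
        have h₃ : (homologyFunctor (ModuleCat.{u} R) i).map g = 0 := by
          rw [← cancel_mono ((homologyFunctor (ModuleCat.{u} R) i).map f), ← Functor.map_comp, h₂,
            Functor.map_zero, zero_comp]
        exact IsZero.of_mono_eq_zero _ h₃
      · exact IsZero.of_mono ((homologyFunctor (ModuleCat.{u} R) i).map g)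
          (isZero_of_isGE X a i hi')
    have hfin (i : ℤ) : Module.Finite R ((homologyFunctor (ModuleCat.{u} R) i).obj X') := by
      refine finite_of_exact (HomologySequence.exact₁ _ mem (i - 1) i) ?_ (hX i)
      change Module.Finite R ((homologyFunctor (ModuleCat.{u} R) (i - 1)).obj
        ((singleFunctor (ModuleCat.{u} R) a).obj I))
      by_cases hi : i - 1 = a
      · rw [hi]
        exact finite_of_mono (homologySingleIso I a).hom hI₁
      · have := ModuleCat.subsingleton_of_isZero (isZero_homology_single I hi)
        infer_instance
    obtain ⟨Z, ι, hZ, hι⟩ := ih X' (a + 1) hfin (by push_cast at hm; lia)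
    refine ⟨Z, ι ≫ g, hZ, fun M t => ?_⟩
    obtain ⟨s, hs⟩ : ∃ s : _ ⟶ X', t = s ≫ g := by
      refine Triangle.coyoneda_exact₂ _ mem t ?_
      refine single_hom_eq_zero_of_ext M I j a (j - a).toNat (by lia) ⟨fun x y => ?_⟩ (t ≫ f)
      obtain ⟨e, he⟩ := Nat.exists_eq_succ_of_ne_zero (show (j - a).toNat ≠ 0 by lia)
      generalize (j - a).toNat = q at *
      subst he
      rw [Abelian.Ext.eq_zero_of_injective x, Abelian.Ext.eq_zero_of_injective y]
    obtain ⟨h, rfl⟩ := hι M s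
    exact ⟨h, by rw [hs, Category.assoc]⟩

end Approximations

/-! ### Rigidity, maximality and functorial finiteness of the closure -/

section Main

open Pretriangulated DerivedCategory

universe w'

variable {R : Type u} [Ring R] [HasDerivedCategory.{w'} (ModuleCat.{u} R)]

lemma toDerived_hom_eq_zero_iff (X Y : Kb R) (i : ℤ)
    {A B : DerivedCategory (ModuleCat.{u} R)} (e : (toDerived R).obj X ≅ A)
    (e' : ((toDerived R).obj Y)⟦i⟧ ≅ B) :
    (∀ f : X ⟶ Y⟦i⟧, f = 0) ↔ ∀ f : A ⟶ B, f = 0 := by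
  constructor
  · intro h f
    obtain ⟨g, hg⟩ := (toDerived R).map_surjective
      (e.hom ≫ f ≫ e'.inv ≫ ((toDerived R).commShiftIso i).inv.app Y)
    rw [h g, Functor.map_zero] at hg
    rw [← cancel_epi e.hom, ← cancel_mono (e'.inv ≫ ((toDerived R).commShiftIso i).inv.app Y),
      Category.assoc, ← hg, comp_zero, zero_comp]
  · intro h f
    apply (toDerived R).map_injective
    have := h (e.inv ≫ (toDerived R).map f ≫ ((toDerived R).commShiftIso i).hom.app Y ≫ e'.hom)
    rw [← cancel_epi e.inv, ← cancel_mono (((toDerived R).commShiftIso i).hom.app Y ≫ e'.hom),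
      Category.assoc, this, Functor.map_zero, comp_zero, zero_comp]

variable {n : ℕ} {C : ObjectProperty (FGModuleCat.{u} R)}

lemma hom_eq_zero_of_shifts
    (hext : ∀ (M N : ModuleCat.{u} R) (i : ℕ), n < i → Subsingleton (Abelian.Ext M N i))
    (hC : IsModuleClusterTilting n C) (X Y : Kb R) (hX : shifts n C X) (hY : shifts n C Y)
    (i : ℤ) (hi₀ : 0 < i) (hi : i < n) (f : X ⟶ Y⟦i⟧) : f = 0 := by
  obtain ⟨M, ℓ, hM, ⟨e⟩⟩ := exists_iso_single_of_shifts hX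
  obtain ⟨N, m, hN, ⟨e'⟩⟩ := exists_iso_single_of_shifts hY
  refine (toDerived_hom_eq_zero_iff X Y i e ((shiftFunctor _ i).mapIso e' ≪≫
    singleShiftIso N.obj i (-(m * n) - i) _ (by lia))).2 (fun g => ?_) f
  -- The Ext degree is `(m - ℓ)n + i`: negative, equal to `i`, or above `n` in the three cases.
  rcases lt_trichotomy m ℓ with h | rfl | h
  · have : (m + 1) * n ≤ ℓ * n := mul_le_mul_of_nonneg_right (by lia) (by lia)
    exact single_hom_eq_zero_of_lt _ _ _ _ (by lia) g
  · exact single_hom_eq_zero_of_ext _ _ _ _ i.toNat (by lia)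
      ((hC.iff_left M).1 hM N hN i.toNat (by lia) (by lia)) g
  · have : (ℓ + 1) * n ≤ m * n := mul_le_mul_of_nonneg_right (by lia) (by lia)
    exact single_hom_eq_zero_of_ext _ _ _ _ (m * n - ℓ * n + i).toNat (by lia)
      (hext _ _ _ (by lia)) g

lemma shiftClosure_of_iso {X : Kb R} (h : ∃ Z : Kb R, shiftClosure n C Z ∧
    Nonempty ((toDerived R).obj Z ≅ (toDerived R).obj X)) : shiftClosure n C X := by
  obtain ⟨Z, ⟨m, Y, b, hY, hb, ⟨r⟩⟩, ⟨e⟩⟩ := h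
  exact ⟨m, Y, b, hY, hb, ⟨(Retract.ofIso ((toDerived R).preimageIso e).symm).trans r⟩⟩

variable [IsNoetherianRing R]

lemma exists_shifts_iso_single (hpd : ∀ M : ModuleCat.{u} R, HasProjectiveDimensionLE M n)
    {X : FGModuleCat.{u} R} (hX : C X) (j : ℤ) (hj : (n : ℤ) ∣ j) :
    ∃ Y : Kb R, shifts n C Y ∧
      Nonempty ((toDerived R).obj Y ≅ (singleFunctor (ModuleCat.{u} R) j).obj X.obj) := by
  obtain ⟨c, rfl⟩ := hj
  obtain ⟨P, ⟨e⟩⟩ := exists_iso_single n X.obj X.property (hpd _)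
  exact ⟨P⟦(-c) * (n : ℤ)⟧, ⟨X, P, -c, hX, (represents_iff P X).2 ⟨e⟩, ⟨Iso.refl _⟩⟩,
    ⟨((toDerived R).commShiftIso _).app P ≪≫ (shiftFunctor _ _).mapIso e ≪≫
      singleShiftIso X.obj _ _ _ (by lia)⟩⟩

/-- Objects with a suitable vanishing property belong to the closure of the shifts of `C`. -/
lemma shiftClosure_of_vanishing
    (hpd : ∀ M : ModuleCat.{u} R, HasProjectiveDimensionLE M n)
    (hext : ∀ (M N : ModuleCat.{u} R) (i : ℕ), n < i → Subsingleton (Abelian.Ext M N i))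
    (Ψ : ObjectProperty (DerivedCategory (ModuleCat.{u} R)))
    (hΨ : ∀ X Y, Nonempty (Retract X Y) → Ψ Y → Ψ X)
    (hΨ' : ∀ X j, (∀ i, Module.Finite R ((homologyFunctor (ModuleCat.{u} R) i).obj X)) → Ψ X →
      ¬ (n : ℤ) ∣ j → IsZero ((homologyFunctor (ModuleCat.{u} R) j).obj X))
    (hΨC : ∀ (N : FGModuleCat.{u} R) (j : ℤ), (n : ℤ) ∣ j →
      Ψ ((singleFunctor (ModuleCat.{u} R) j).obj N.obj) → C N)
    (X : Kb R) (hX : Ψ ((toDerived R).obj X)) : shiftClosure n C X := by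
  obtain ⟨a, b, _, _⟩ := exists_isGE_isLE X
  -- Finiteness of cohomology is carried along, so that the cohomology objects can be tested for
  -- membership in `C`.
  let Φ : ObjectProperty (DerivedCategory (ModuleCat.{u} R)) := fun X => Ψ X ∧
    ∀ i, Module.Finite R ((homologyFunctor (ModuleCat.{u} R) i).obj X)
  let U : ObjectProperty (DerivedCategory (ModuleCat.{u} R)) := fun X =>
    ∃ Z : Kb R, shiftClosure n C Z ∧ Nonempty ((toDerived R).obj Z ≅ X)
  have hS : (ModuleCat.isFG.{u} R).IsClosedUnderIsomorphisms :=
    ⟨fun e h => finite_of_epi e.hom h⟩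
  refine shiftClosure_of_iso (prop_of_homology_concentrated n hext Φ U ?_
    (fun X j h => hΨ' X j h.2 h.1) ?_ ?_ (ModuleCat.isFG.{u} R) ?_ _ a b
    (fun j _ => finite_homology_toDerived X j) ⟨hX, finite_homology_toDerived X⟩)
  · rintro X Y ⟨r⟩ ⟨h₁, h₂⟩
    exact ⟨hΨ X Y ⟨r⟩ h₁, fun i =>
      finite_of_epi (r.map (homologyFunctor (ModuleCat.{u} R) i)).r (h₂ i)⟩
  · intro Z hZ
    obtain ⟨Z', hZ'⟩ := HasZeroObject.zero (C := Kb R)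
    exact ⟨Z', add_of_isZero hZ', ⟨((toDerived R).map_isZero hZ').iso hZ⟩⟩
  · rintro T hT h₀ ⟨Z₁, hZ₁, ⟨e₁⟩⟩ ⟨Z₃, hZ₃, ⟨e₃⟩⟩
    obtain ⟨e, -⟩ := exists_iso_binaryBiproduct_of_distTriang T hT h₀
    have := preservesBinaryBiproducts_of_preservesBiproducts (toDerived R)
    exact ⟨Z₁ ⊞ Z₃, add_of_split hZ₁ hZ₃ biprod.fst biprod.inl biprod.snd biprod.inr biprod.total,
      ⟨(toDerived R).mapBiprod _ _ ≪≫ biprod.mapIso e₁ e₃ ≪≫ e.symm⟩⟩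
  · intro N j hN hj h
    obtain ⟨Y, hY, e⟩ := exists_shifts_iso_single hpd (hΨC ⟨N, hN⟩ j hj h.1) j hj
    exact ⟨Y, add_of_mem hY, e⟩

lemma shiftClosure_of_hom_to_eq_zero
    (hpd : ∀ M : ModuleCat.{u} R, HasProjectiveDimensionLE M n)
    (hext : ∀ (M N : ModuleCat.{u} R) (i : ℕ), n < i → Subsingleton (Abelian.Ext M N i))
    (hn : 1 ≤ n) (hC : IsModuleClusterTilting n C) (X : Kb R)
    (hX : ∀ Y, shiftClosure n C Y → ∀ i : ℤ, 0 < i → i < n → ∀ f : Y ⟶ X⟦i⟧, f = 0) :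
    shiftClosure n C X := by
  -- Orthogonality is stated for all derived objects, since the truncations of `X` are not known to
  -- come from `Kb R`.
  let Ψ : ObjectProperty (DerivedCategory (ModuleCat.{u} R)) := fun X' =>
    ∀ Y : Kb R, shiftClosure n C Y → ∀ i : ℤ, 0 < i → i < n →
      ∀ f : (toDerived R).obj Y ⟶ X'⟦i⟧, f = 0
  have hΨs (X') (h : Ψ X') (N : FGModuleCat.{u} R) (hN : C N) (j : ℤ) (hj : (n : ℤ) ∣ j)
      (i : ℤ) (hi₀ : 0 < i) (hi : i < n)
      (f : (singleFunctor (ModuleCat.{u} R) j).obj N.obj ⟶ X'⟦i⟧) : f = 0 := by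
    obtain ⟨Y, hY, ⟨e⟩⟩ := exists_shifts_iso_single hpd hN j hj
    rw [← cancel_epi e.hom, comp_zero]
    exact h Y (add_of_mem hY) i hi₀ hi _
  refine shiftClosure_of_vanishing hpd hext Ψ ?_ ?_ ?_ X ?_
  · rintro X Y ⟨r⟩ h Z hZ i hi₀ hi f
    have := h Z hZ i hi₀ hi (f ≫ r.i⟦i⟧')
    rw [← Category.comp_id f, ← CategoryTheory.Functor.map_id, ← r.retract, Functor.map_comp,
      reassoc_of% this, zero_comp]
  · intro X j hfin h hj
    obtain ⟨P, p, hP₁, hP₂, hP₃⟩ := exists_epi_from_finite_projective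
      ((homologyFunctor (ModuleCat.{u} R) j).obj X)
    obtain ⟨f, hf⟩ := exists_hom_from_single_projective X j P p
    -- Shifting by `j % n` moves `P` to degree `j - j % n`, a multiple of `n`, where orthogonality
    -- applies.
    have hi₀ : 0 < j % n := lt_of_le_of_ne (Int.emod_nonneg _ (by lia))
      (fun h => hj (Int.dvd_of_emod_eq_zero h.symm))
    have hf₀ : f = 0 := by
      apply (shiftFunctor _ (j % n)).map_injective
      rw [Functor.map_zero, ← cancel_epi (singleShiftIso P (j % n) (j - j % n) j (by lia)).inv,
        comp_zero]
      exact hΨs X h ⟨P, hP₁⟩ (mem_of_projective hC _ hP₂) _ (Int.dvd_self_sub_emod) _ hi₀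
        (Int.emod_lt_of_pos _ (by lia)) _
    rw [hf₀, Functor.map_zero, comp_zero] at hf
    exact IsZero.of_epi_eq_zero p hf.symm
  · intro N j hj h
    refine (hC.iff_right N).2 fun Y hY i hi₀ hi => ?_
    refine subsingleton_ext_of_single_hom _ _ j (j - i) i (by lia) fun f => ?_
    rw [← cancel_mono (singleShiftIso N.obj i (j - i) j (by lia)).inv, zero_comp]
    exact hΨs _ h Y hY j hj i (by lia) (by lia) _
  · intro Y hY i hi₀ hi
    exact (toDerived_hom_eq_zero_iff Y X i (Iso.refl _) (Iso.refl _)).1 (hX Y hY i hi₀ hi)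

lemma shiftClosure_of_hom_from_eq_zero
    (hinj : ∀ M : ModuleCat.{u} R, Module.Finite R M →
      ∃ (I : ModuleCat.{u} R) (i : M ⟶ I), Module.Finite R I ∧ Injective I ∧ Mono i)
    (hpd : ∀ M : ModuleCat.{u} R, HasProjectiveDimensionLE M n)
    (hext : ∀ (M N : ModuleCat.{u} R) (i : ℕ), n < i → Subsingleton (Abelian.Ext M N i))
    (hn : 1 ≤ n) (hC : IsModuleClusterTilting n C) (X : Kb R)
    (hX : ∀ Y, shiftClosure n C Y → ∀ i : ℤ, 0 < i → i < n → ∀ f : X ⟶ Y⟦i⟧, f = 0) :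
    shiftClosure n C X := by
  let Ψ : ObjectProperty (DerivedCategory (ModuleCat.{u} R)) := fun X' =>
    ∀ Y : Kb R, shiftClosure n C Y → ∀ i : ℤ, 0 < i → i < n →
      ∀ f : X' ⟶ ((toDerived R).obj Y)⟦i⟧, f = 0
  have hΨs (X') (h : Ψ X') (N : FGModuleCat.{u} R) (hN : C N) (j : ℤ)
      (i : ℤ) (hi₀ : 0 < i) (hi : i < n) (hj : (n : ℤ) ∣ j + i)
      (f : X' ⟶ (singleFunctor (ModuleCat.{u} R) j).obj N.obj) : f = 0 := by
    obtain ⟨Y, hY, ⟨e⟩⟩ := exists_shifts_iso_single hpd hN (j + i) hj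
    rw [← cancel_mono ((singleShiftIso N.obj i j (j + i) (by lia)).inv ≫ e.inv⟦i⟧'), zero_comp]
    exact h Y (add_of_mem hY) i hi₀ hi _
  refine shiftClosure_of_vanishing hpd hext Ψ ?_ ?_ ?_ X ?_
  · rintro X Y ⟨r⟩ h Z hZ i hi₀ hi f
    have := h Z hZ i hi₀ hi (r.r ≫ f)
    rw [← Category.id_comp f, ← r.retract, Category.assoc, this, comp_zero]
  · intro X j hfin h hj
    obtain ⟨I, φ, hI₁, hI₂, hI₃⟩ := hinj _ (hfin j)
    obtain ⟨f, hf⟩ := exists_hom_to_single_injective X j I φ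
    have hj' : ¬ (n : ℤ) ∣ -j := fun h => hj ((Int.dvd_neg).1 h)
    -- With `i = (-j) % n`, the stalk of `I` in degree `j` is the shift by `i` of the one in degree
    -- `j + i`, a multiple of `n`.
    have hi₀ : 0 < (-j) % n := lt_of_le_of_ne (Int.emod_nonneg _ (by lia))
      (fun h => hj' (Int.dvd_of_emod_eq_zero h.symm))
    have hf₀ : f = 0 := by
      refine hΨs X h ⟨I, hI₁⟩ (mem_of_injective hC _ hI₂) j ((-j) % n) hi₀
        (Int.emod_lt_of_pos _ (by lia)) ?_ f
      have := Int.dvd_self_sub_emod (x := -j) (m := n)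
      rw [← Int.dvd_neg] at this
      convert this using 1
      ring
    rw [hf₀, Functor.map_zero, zero_comp] at hf
    exact IsZero.of_mono_eq_zero φ hf.symm
  · intro N j hj h
    refine (hC.iff_left N).2 fun Y hY i hi₀ hi => ?_
    refine subsingleton_ext_of_single_hom _ _ j (j - i) i (by lia) fun f => ?_
    exact hΨs _ h Y hY (j - i) i (by lia) (by lia) (by simpa using hj) f
  · intro Y hY i hi₀ hi
    exact (toDerived_hom_eq_zero_iff X Y i (Iso.refl _) (Iso.refl _)).1 (hX Y hY i hi₀ hi)

lemma isCovariantlyFinite_shiftClosure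
    (hpd : ∀ M : ModuleCat.{u} R, HasProjectiveDimensionLE M n)
    (hext : ∀ (M N : ModuleCat.{u} R) (i : ℕ), n < i → Subsingleton (Abelian.Ext M N i))
    (hn : 1 ≤ n) (hC : IsCovariantlyFinite C) : IsCovariantlyFinite (shiftClosure n C) := by
  intro X
  obtain ⟨a, b, _, _⟩ := exists_isGE_isLE X
  let L : ℤ → ObjectProperty (Kb R) := fun ℓ Y => ∃ N : FGModuleCat.{u} R, C N ∧
    Nonempty ((toDerived R).obj Y ≅ (singleFunctor (ModuleCat.{u} R) (-(ℓ * n))).obj N.obj)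
  -- A nonzero morphism from `X` to a stalk in degree `-ℓn` forces `a - n ≤ -ℓn ≤ b`; since `n ≥ 1`,
  -- this puts `ℓ` in the interval below.
  obtain ⟨A, f, hA, hf⟩ := exists_left_approximation_of_finset (S := shifts n C) L X
    (Finset.Icc (-|b|) (1 + |a|)) (by
      intro ℓ _
      obtain ⟨W, π, hW, hπ⟩ := exists_universal_hom_to_single X (-(ℓ * n))
      obtain ⟨N, g, hN, hg⟩ := hC ⟨W, hW⟩
      obtain ⟨A, hA, ⟨e⟩⟩ := exists_shifts_iso_single hpd hN (-(ℓ * n)) ⟨-ℓ, by ring⟩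
      obtain ⟨f, hf⟩ := (toDerived R).map_surjective
        (π ≫ (singleFunctor (ModuleCat.{u} R) (-(ℓ * n))).map g.hom ≫ e.inv)
      refine ⟨A, f, add_of_mem hA, ?_⟩
      rintro Y ⟨N', hN', ⟨e'⟩⟩ t
      obtain ⟨h, hh⟩ := hπ N'.obj ((toDerived R).map t ≫ e'.hom)
      obtain ⟨s, hs⟩ := hg N' hN' (ObjectProperty.homMk h)
      obtain ⟨s', hs'⟩ := (toDerived R).map_surjective
        (e.hom ≫ (singleFunctor (ModuleCat.{u} R) (-(ℓ * n))).map s.hom ≫ e'.inv)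
      refine ⟨s', (toDerived R).map_injective ?_⟩
      have hs₀ : g.hom ≫ s.hom = h := congrArg (·.hom) hs
      rw [Functor.map_comp, hf, hs', Category.assoc, Category.assoc, e.inv_hom_id_assoc,
        ← Functor.map_comp_assoc, hs₀, ← Category.assoc, hh, Category.assoc, e'.hom_inv_id,
        Category.comp_id])
  refine ⟨A, f, hA, fun Y hY g => left_approximation_add f ?_ Y hY g⟩
  intro Y hY g
  obtain ⟨N, ℓ, hN, ⟨e⟩⟩ := exists_iso_single_of_shifts hY
  by_cases hℓ : ℓ ∈ Finset.Icc (-|b|) (1 + |a|)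
  · exact hf ℓ hℓ Y ⟨N, hN, ⟨e⟩⟩ g
  refine ⟨0, ?_⟩
  rw [comp_zero]
  apply (toDerived R).map_injective
  rw [Functor.map_zero, ← cancel_mono e.hom, zero_comp]
  rw [Finset.mem_Icc, not_and_or, not_le, not_le] at hℓ
  have hn' : (1 : ℤ) ≤ n := by lia
  rcases hℓ with hℓ | hℓ
  · have h₁ : (-ℓ) * 1 ≤ (-ℓ) * n := mul_le_mul_of_nonneg_left hn' (by linarith [abs_nonneg b])
    exact (TStructure.t.zero _ b (-(ℓ * n)) (by linarith [le_abs_self b])).symm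
  · have h₁ : (ℓ - 1) * 1 ≤ (ℓ - 1) * n :=
      mul_le_mul_of_nonneg_left hn' (by linarith [abs_nonneg a])
    exact (hom_to_single_eq_zero n hext _ a b (-(ℓ * n)) (by linarith [neg_abs_le a]) _ _).symm

lemma isContravariantlyFinite_shiftClosure
    (hinj : ∀ M : ModuleCat.{u} R, Module.Finite R M →
      ∃ (I : ModuleCat.{u} R) (i : M ⟶ I), Module.Finite R I ∧ Injective I ∧ Mono i)
    (hpd : ∀ M : ModuleCat.{u} R, HasProjectiveDimensionLE M n)
    (hext : ∀ (M N : ModuleCat.{u} R) (i : ℕ), n < i → Subsingleton (Abelian.Ext M N i))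
    (hn : 1 ≤ n) (hC : IsContravariantlyFinite C) :
    IsContravariantlyFinite (shiftClosure n C) := by
  intro X
  obtain ⟨a, b, _, _⟩ := exists_isGE_isLE X
  let L : ℤ → ObjectProperty (Kb R) := fun ℓ Y => ∃ N : FGModuleCat.{u} R, C N ∧
    Nonempty ((toDerived R).obj Y ≅ (singleFunctor (ModuleCat.{u} R) (-(ℓ * n))).obj N.obj)
  -- Here a nonzero morphism forces `a ≤ -ℓn ≤ b + n`, hence the reflected interval.
  obtain ⟨A, f, hA, hf⟩ := exists_right_approximation_of_finset (S := shifts n C) L X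
    (Finset.Icc (-1 - |b|) |a|) (by
      intro ℓ _
      obtain ⟨Z, ι, hZ, hι⟩ := exists_universal_hom_from_single hinj ((toDerived R).obj X) a
        (-(ℓ * n)) (finite_homology_toDerived X)
      obtain ⟨N, g, hN, hg⟩ := hC ⟨Z, hZ⟩
      obtain ⟨A, hA, ⟨e⟩⟩ := exists_shifts_iso_single hpd hN (-(ℓ * n)) ⟨-ℓ, by ring⟩
      obtain ⟨f, hf⟩ := (toDerived R).map_surjective
        (e.hom ≫ (singleFunctor (ModuleCat.{u} R) (-(ℓ * n))).map g.hom ≫ ι)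
      refine ⟨A, f, add_of_mem hA, ?_⟩
      rintro Y ⟨N', hN', ⟨e'⟩⟩ t
      obtain ⟨h, hh⟩ := hι N'.obj (e'.inv ≫ (toDerived R).map t)
      obtain ⟨s, hs⟩ := hg N' hN' (ObjectProperty.homMk h)
      obtain ⟨s', hs'⟩ := (toDerived R).map_surjective
        (e'.hom ≫ (singleFunctor (ModuleCat.{u} R) (-(ℓ * n))).map s.hom ≫ e.inv)
      refine ⟨s', (toDerived R).map_injective ?_⟩
      have hs₀ : s.hom ≫ g.hom = h := congrArg (·.hom) hs
      rw [Functor.map_comp, hf, hs', Category.assoc, Category.assoc, e.inv_hom_id_assoc,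
        ← Functor.map_comp_assoc, hs₀, hh, e'.hom_inv_id_assoc])
  refine ⟨A, f, hA, fun Y hY g => right_approximation_add f ?_ Y hY g⟩
  intro Y hY g
  obtain ⟨N, ℓ, hN, ⟨e⟩⟩ := exists_iso_single_of_shifts hY
  by_cases hℓ : ℓ ∈ Finset.Icc (-1 - |b|) |a|
  · exact hf ℓ hℓ Y ⟨N, hN, ⟨e⟩⟩ g
  refine ⟨0, ?_⟩
  rw [zero_comp]
  apply (toDerived R).map_injective
  rw [Functor.map_zero, ← cancel_epi e.inv, comp_zero]
  rw [Finset.mem_Icc, not_and_or, not_le, not_le] at hℓ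
  have hn' : (1 : ℤ) ≤ n := by lia
  rcases hℓ with hℓ | hℓ
  · have h₁ : (-ℓ - 1) * 1 ≤ (-ℓ - 1) * n :=
      mul_le_mul_of_nonneg_left hn' (by linarith [abs_nonneg b])
    exact (hom_from_single_eq_zero n hext _ a b (-(ℓ * n)) (by linarith [le_abs_self b]) _ _).symm
  · have h₁ : ℓ * 1 ≤ ℓ * n := mul_le_mul_of_nonneg_left hn' (by linarith [abs_nonneg a])
    exact (TStructure.t.zero _ (-(ℓ * n)) a (by linarith [neg_abs_le a])).symm

end Main

/-- Over a finite dimensional algebra of global dimension at most `n`, the `n`-shifts of an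
`n`-cluster tilting subcategory of modules form an `n`-cluster tilting subcategory of
`K^b(proj R)`. -/
theorem isTriangulatedClusterTilting_shiftClosure (k : Type w) {R : Type u} [Field k] [Ring R]
    [Algebra k R] [Module.Finite k R] {n : ℕ} (hn : 1 ≤ n) (hgl : globalDimension R ≤ n)
    {C : ObjectProperty (FGModuleCat.{u} R)} (hC : IsModuleClusterTilting n C) :
    IsTriangulatedClusterTilting n (shiftClosure n C) := by
  have := isNoetherianRing_of_finite R k
  let := HasDerivedCategory.standard (ModuleCat.{u} R)
  have hpd (M : ModuleCat.{u} R) : HasProjectiveDimensionLE M n :=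
    hasProjectiveDimensionLE_of_globalDimension_le hgl M
  have hext (M N : ModuleCat.{u} R) (i : ℕ) (hi : n < i) : Subsingleton (Abelian.Ext M N i) :=
    HasProjectiveDimensionLT.subsingleton M (n + 1) i hi N
  have hinj (M : ModuleCat.{u} R) (_ : Module.Finite R M) :=
    exists_mono_to_finite_injective k M
  have hrigid (X Y : Kb R) (hX : shiftClosure n C X) (hY : shiftClosure n C Y) (i : ℤ)
      (hi₀ : 0 < i) (hi : i < n) (f : X ⟶ Y⟦i⟧) : f = 0 :=
    hom_eq_zero_of_add hX hY (shiftFunctor _ i)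
      (fun X' Y' hX' hY' => hom_eq_zero_of_shifts hext hC X' Y' hX' hY' i hi₀ hi) f
  exact {
    functoriallyFinite :=
      ⟨isContravariantlyFinite_shiftClosure hinj hpd hext hn hC.functoriallyFinite.1,
        isCovariantlyFinite_shiftClosure hpd hext hn hC.functoriallyFinite.2⟩
    iff_left := fun X => ⟨fun hX Y hY i hi₀ hi f => hrigid X Y hX hY i hi₀ hi f,
      shiftClosure_of_hom_from_eq_zero hinj hpd hext hn hC X⟩
    iff_right := fun X => ⟨fun hX Y hY i hi₀ hi f => hrigid Y X hY hX i hi₀ hi f,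
      shiftClosure_of_hom_to_eq_zero hpd hext hn hC X⟩ }

end ClusterTilting

theorem mainTheorem7 {k : Type w} {Λ : Type u} [Field k] [Ring Λ] [Algebra k Λ]
    [Module.Finite k Λ] (n : ℕ) (hn : 1 ≤ n)
    (hgl : ClusterTilting.globalDimension Λᵐᵒᵖ ≤ n)
    (C : ObjectProperty (FGModuleCat.{u} Λᵐᵒᵖ))
    (hC : ClusterTilting.IsModuleClusterTilting n C) :
    ClusterTilting.IsTriangulatedClusterTilting n (ClusterTilting.shiftClosure n C) := by
  -- Right `Λ`-modules are left modules over the opposite algebra, which has the same dimension over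
  -- `k`.
  have : Module.Finite k Λᵐᵒᵖ := Module.Finite.equiv (MulOpposite.opLinearEquiv k)
  exact ClusterTilting.isTriangulatedClusterTilting_shiftClosure k hn hgl hC
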